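/- **Setting.** Consider a finite-horizon episodic MDP with a finite state space of size $S$, a finite action space of size $A$, horizon $H$, and deterministic stationary transitions $s'=f(s,a)$ and rewards $r(s,a)\in[0,1]$. For a time-dependent policy $\pi$ let $V_1^\pi(s)=\sum_{t=1}^H r(s_t,\pi(s_t,t))$ be the return along the trajectory from $s_1=s$, and $V_1^*(s)=\sup_\pi V_1^\pi(s)$. The agent plays $K$ episodes with arbitrary initial states $s_{1},\dots,s_{K}$ (where $s_k$ starts episode $k$), using policy $\pi_k$ in episode $k$. Put $T=KH$ and $$\mathrm{Regret}(K)=\sum_{k=1}^K\bigl(V_1^*(s_{k})-V_1^{\pi_k}(s_{k})\bigr).$$ **Algorithm (EULER with Bernstein bonuses, confidence parameter $\delta\in(0,1)$).** Let $\delta'=\delta/7$, $L=\ln\frac{4SAT}{\delta'}$, $J=\frac{HL}{3}$, $B_p=H\sqrt{2L}$, $B_v=\sqrt{2L}$. At the start of episode $k$, let $n(s,a)$, $\hat p(\cdot\mid s,a)$, $\hat r(s,a)$ and $\widehat{\mathrm{Var}}R(s,a)$ be the visit count, the empirical transition frequencies, the empirical mean reward and the sample variance of the rewards, computed from all previous episodes.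 Write $\|X\|_{2,p}=\sqrt{\sum_{s'}p(s')X(s')^2}$ and $$b^r(s,a)=\sqrt{\tfrac{2\widehat{\mathrm{Var}}R(s,a)L}{n(s,a)}}+\tfrac{7L}{3n(s,a)},\qquad \phi(s,a,V)=\sqrt{\tfrac{2\mathrm{Var}_{\hat p(\cdot\mid s,a)}(V)L}{n(s,a)}}+\tfrac{J}{n(s,a)}.$$ Set $\overline V_{H+1}=\underline V_{H+1}=0$ and, for $t=H,\dots,1$, $$b(s,a,V)=\phi(s,a,V)+\tfrac1{\sqrt{n(s,a)}}\Bigl(\tfrac{4J+B_p}{\sqrt{n(s,a)}}+B_v\|\overline V_{t+1}-\underline V_{t+1}\|_{2,\hat p(\cdot\mid s,a)}\Bigr),$$ $$Q_t(s,a)=\min\bigl\{H-t+1,\ \hat r(s,a)+b^r(s,a)+\hat p(\cdot\mid s,a)^\top\overline V_{t+1}+b(s,a,\overline V_{t+1})\bigr\}.$$ Let $\pi_k(s,t)\in\arg\max_a Q_t(s,a)$ with arbitrary tie-breaking and, with $a=\pi_k(s,t)$, put $\overline V_t(s)=Q_t(s,a)$ and $$\underline V_t(s)=\max\bigl\{0,\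 \hat r(s,a)-b^r(s,a)+\hat p(\cdot\mid s,a)^\top\underline V_{t+1}-b(s,a,\underline V_{t+1})\bigr\}.$$ If $n(s,a)=0$, the bonuses count as infinite, i.e. $Q_t(s,a)=H-t+1$, and $\underline V_t(s)=0$ when such an $a$ is chosen. **Proposition.** There are absolute constants $C>0$ and $m\in\mathbb N$ such that for every such deterministic MDP, all $H,K$, every $\delta\in(0,1)$, all initial states and every tie-breaking, EULER with Bernstein bonuses satisfies (with certainty) $$\mathrm{Regret}(K)\ \le\ C\,SAH^2\,\Bigl(\ln\frac{28\,SAT}{\delta}\Bigr)^m,$$ that is, its regret is $\tilde O(SAH^2)$: polylogarithmic in $T$, with no $\sqrt T$ dependence. (For $T=0$ the regret is $0$, and $\ln 0$ is read as $0$.) -/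

import Mathlib

open Finset

/-- A stationary MDP with state space `S`, action space `A`, deterministic transitions
`s' = next s a` and deterministic rewards `reward s a ∈ [0, 1]`. -/
structure DetMDP (S A : Type*) where
  next : S → A → S
  reward : S → A → ℝ
  reward_mem : ∀ s a, reward s a ∈ Set.Icc (0 : ℝ) 1

/-- One observed transition: in `state` the agent took `action`, collected `reward` and moved to
`nextState`. -/
structure Obs (S A : Type*) where
  state : S
  action : A
  reward : ℝ
  nextState : S

noncomputable section

namespace DetMDP

variable {S A : Type*}

/-- The states of an episode that starts in `s` and follows the nonstationary policy `π`.
Timesteps are numbered from `0`, so that an episode has the timesteps `0, …, H - 1`. -/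
def stateAt (M : DetMDP S A) (π : ℕ → S → A) (s : S) : ℕ → S
  | 0 => s
  | t + 1 => M.next (stateAt M π s t) (π t (stateAt M π s t))

/-- The value `V₁^π(s)`: the return over the `H` steps of an episode. -/
def value (M : DetMDP S A) (H : ℕ) (π : ℕ → S → A) (s : S) : ℝ :=
  ∑ t ∈ range H, M.reward (M.stateAt π s t) (π t (M.stateAt π s t))

/-- The optimal value `V₁^*(s)`, the supremum over all (time dependent) policies. -/
def optValue (M : DetMDP S A) (H : ℕ) (s : S) : ℝ :=
  ⨆ π : ℕ → S → A, M.value H π s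

/-- The observations collected in one episode of length `H`. -/
def episode (M : DetMDP S A) (H : ℕ) (π : ℕ → S → A) (s : S) : List (Obs S A) :=
  (List.range H).map fun t =>
    { state := M.stateAt π s t
      action := π t (M.stateAt π s t)
      reward := M.reward (M.stateAt π s t) (π t (M.stateAt π s t))
      nextState := M.stateAt π s (t + 1) }

end DetMDP

namespace Euler

variable {S A : Type*} [Fintype S] [DecidableEq S] [DecidableEq A]

/-! ### Empirical quantities, computed from an arbitrary list `D` of observations -/

/-- The observations in `D` that were made at the pair `(s, a)`. -/
def samples (D : List (Obs S A)) (s : S) (a : A) : List (Obs S A) :=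
  D.filter fun o => decide (o.state = s ∧ o.action = a)

/-- The visit count `n(s, a)`. -/
def visits (D : List (Obs S A)) (s : S) (a : A) : ℕ :=
  (samples D s a).length

/-- The maximum likelihood estimate of the transition probabilities. -/
def pHat (D : List (Obs S A)) (s : S) (a : A) (s' : S) : ℝ :=
  (((samples D s a).filter fun o => decide (o.nextState = s')).length : ℝ) / visits D s a

/-- The maximum likelihood estimate of the mean reward. -/
def rHat (D : List (Obs S A)) (s : S) (a : A) : ℝ :=
  ((samples D s a).map fun o => o.reward).sum / visits D s a

/-- The (unbiased) sample variance of the rewards observed at `(s, a)`; it is `0` for a single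
observation. -/
def rVar (D : List (Obs S A)) (s : S) (a : A) : ℝ :=
  ((samples D s a).map fun o => (o.reward - rHat D s a) ^ 2).sum / ((visits D s a : ℝ) - 1)

/-- Expectation of `V` under the weights `p`. -/
def mean (p V : S → ℝ) : ℝ := ∑ s', p s' * V s'

/-- Variance of `V` under the weights `p`. -/
def variance (p V : S → ℝ) : ℝ := ∑ s', p s' * (V s' - mean p V) ^ 2

/-- The norm `‖X‖_{2,p}`. -/
def norm2 (p X : S → ℝ) : ℝ := √(∑ s', p s' * X s' ^ 2)

/-! ### Bonuses. Throughout, `L` stands for the logarithm `ln (4SAT/δ')`. -/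

/-- The logarithm `ln (4SAT/δ')` with `T = KH` and `δ' = δ/7`. -/
def logTerm (S A : Type*) [Fintype S] [Fintype A] (H K : ℕ) (δ : ℝ) : ℝ :=
  Real.log (4 * Fintype.card S * Fintype.card A * ((K : ℝ) * H) / (δ / 7))

/-- The empirical Bernstein bonus for the rewards. -/
def rewardBonus (L : ℝ) (D : List (Obs S A)) (s : S) (a : A) : ℝ :=
  √(2 * rVar D s a * L / visits D s a) + 7 * L / (3 * visits D s a)

def constJ (L : ℝ) (H : ℕ) : ℝ := H * L / 3

def constBp (L : ℝ) (H : ℕ) : ℝ := H * √(2 * L)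

def constBv (L : ℝ) : ℝ := √(2 * L)

/-- The Bernstein confidence interval `φ(p̂(s,a), V)` for the transition dynamics. -/
def phi (L : ℝ) (H : ℕ) (D : List (Obs S A)) (s : S) (a : A) (V : S → ℝ) : ℝ :=
  √(2 * variance (pHat D s a) V * L / visits D s a) + constJ L H / visits D s a

/-- The transition bonus: `φ(p̂(s,a), V)` plus the correction that accounts for the distance between
the upper and the lower estimate of the next-step value function. -/
def transBonus (L : ℝ) (H : ℕ) (D : List (Obs S A)) (Vup Vlo : S → ℝ) (s : S) (a : A)
    (V : S → ℝ) : ℝ :=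
  phi L H D s a V + 1 / √(visits D s a) *
    ((4 * constJ L H + constBp L H) / √(visits D s a)
      + constBv L * norm2 (pHat D s a) (fun s' => Vup s' - Vlo s'))

/-! ### Planning -/

/-- The optimistic action value when `h` steps remain, the current one included, and `Vup`, `Vlo`
are the estimates for the next timestep. It is capped at `h`; for a pair without observations the
bonus counts as infinite, so the value is the cap. -/
def qUp (L : ℝ) (H : ℕ) (D : List (Obs S A)) (h : ℕ) (Vup Vlo : S → ℝ) (s : S) (a : A) : ℝ :=
  if visits D s a = 0 then h
  else min (h : ℝ)
    (rHat D s a + rewardBonus L D s a + mean (pHat D s a) Vup + transBonus L H D Vup Vlo s a Vup)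

/-- The pessimistic action value; it is `0` for a pair without observations. -/
def qLo (L : ℝ) (H : ℕ) (D : List (Obs S A)) (Vup Vlo : S → ℝ) (s : S) (a : A) : ℝ :=
  if visits D s a = 0 then 0
  else max 0
    (rHat D s a - rewardBonus L D s a + mean (pHat D s a) Vlo - transBonus L H D Vup Vlo s a Vlo)

/-- The pair of the upper and the lower value estimate when `h` steps remain. The action in state
`s` with `h + 1` steps remaining is chosen by the selector `sel h s` from the function `qUp`. -/
def bounds (sel : ℕ → S → (A → ℝ) → A) (L : ℝ) (H : ℕ) (D : List (Obs S A)) :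
    ℕ → (S → ℝ) × (S → ℝ)
  | 0 => (fun _ => 0, fun _ => 0)
  | h + 1 =>
    let V := bounds sel L H D h
    let act : S → A := fun s => sel h s (qUp L H D (h + 1) V.1 V.2 s)
    (fun s => qUp L H D (h + 1) V.1 V.2 s (act s), fun s => qLo L H D V.1 V.2 s (act s))

/-- The policy planned from the observations `D`: at timestep `t < H` there are `H - t` steps
remaining, the current one included. -/
def policy (sel : ℕ → S → (A → ℝ) → A) (L : ℝ) (H : ℕ) (D : List (Obs S A)) (t : ℕ) (s : S) : A :=
  sel (H - 1 - t) s
    (qUp L H D (H - 1 - t + 1) (bounds sel L H D (H - 1 - t)).1 (bounds sel L H D (H - 1 - t)).2 s)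

/-! ### Interaction with a deterministic MDP -/

/-- The observations available at the beginning of episode `k` (episodes are numbered from `0`),
when episode `k` starts in `s₁ k` and its actions are selected by `sel k`. -/
def history (M : DetMDP S A) (sel : ℕ → ℕ → S → (A → ℝ) → A) (L : ℝ) (H : ℕ) (s₁ : ℕ → S) :
    ℕ → List (Obs S A)
  | 0 => []
  | k + 1 =>
    history M sel L H s₁ k ++ M.episode H (policy (sel k) L H (history M sel L H s₁ k)) (s₁ k)

/-- The regret of `K` episodes of EULER with Bernstein bonuses and confidence parameter `δ`. -/
def regret [Fintype A] (M : DetMDP S A) (sel : ℕ → ℕ → S → (A → ℝ) → A) (H K : ℕ) (δ : ℝ)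
    (s₁ : ℕ → S) : ℝ :=
  ∑ k ∈ range K, (M.optValue H (s₁ k) -
    M.value H (policy (sel k) (logTerm S A H K δ) H
      (history M sel (logTerm S A H K δ) H s₁ k)) (s₁ k))

end Euler

end

/-!
With deterministic dynamics the empirical model of a pair `(s, a)` is exact as soon as the pair has
been visited once: the empirical transition law is a point mass and both variances vanish.  The
bonus then has the form `β / n + B_v / √n · |V̄ - V̲|(s')` with `β = O(HL)` and `B_v = O(√L)`.

Fix an episode, with counts `n_t ≥ 1` along its trajectory, and let `d_t` be the gap `V̄ - V̲` at
its `t`-th state.  By optimism (`value_le_bounds_fst`) the regret of the episode is at most the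
excess of `V̄` over the return, which telescopes to `∑ t, (β / n_t + B_v / √n_t · d_{t+1})`.  The gap
itself satisfies `d_t ≤ 2 (β / n_t + B_v / √n_t · d_{t+1}) + d_{t+1}`, and `0 ≤ d_t ≤ H`, so that
`d_t ≤ O(HL) · ∑ τ, 1 / √n_τ`.  Inserting this and applying the Cauchy-Schwarz inequality
`(∑ t, 1 / √n_t)² ≤ H ∑ t, 1 / n_t` bounds the regret by `O(H² L²) · ∑ t, 1 / n_t`
(`excess_le_of_gap_recursion`).  There is no `√T` because every contribution is of order `1 / n`.

The sum over episodes is controlled by the potential `Ψ = ∑ (s, a), log (1 + n(s, a))`.  If every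
pair is visited in the episode at most as often as it had been visited before, then
`∑ t, 1 / n_t` is at most three times the increase of `Ψ`.  Otherwise the count of some pair at least
doubles, `Ψ` grows by at least `log 2`, and the trivial bound `H` on the regret of the episode
suffices.  Either way the regret is at most `O(H² L²)` times the increase of `Ψ`
(`episode_regret_le`), and `Ψ` never exceeds `SA log (1 + T)`.
-/

/-! ### The logarithmic potential -/

theorem log_two_le_log_sub_log {n w : ℕ} (h : n < w) :
    Real.log 2 ≤ Real.log (1 + ((n + w : ℕ) : ℝ)) - Real.log (1 + (n : ℝ)) := by
  have hn : (0 : ℝ) < 1 + n := by positivity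
  have hw : (n : ℝ) + 1 ≤ w := by exact_mod_cast h
  rw [le_sub_iff_add_le, ← Real.log_mul two_ne_zero hn.ne']
  apply Real.log_le_log (by positivity)
  push_cast
  linarith

theorem log_one_add_sub_nonneg {n w : ℕ} :
    0 ≤ Real.log (1 + ((n + w : ℕ) : ℝ)) - Real.log (1 + (n : ℝ)) := by
  rw [sub_nonneg]
  apply Real.log_le_log (by positivity)
  push_cast
  linarith [Nat.cast_nonneg (α := ℝ) w]

theorem div_le_three_mul_log_sub_log {n w : ℕ} (h : w ≤ n) :
    (w : ℝ) / n ≤ 3 * (Real.log (1 + ((n + w : ℕ) : ℝ)) - Real.log (1 + (n : ℝ))) := by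
  rcases Nat.eq_zero_or_pos n with rfl | hpos
  · obtain rfl : w = 0 := by omega
    simp
  have hn : (1 : ℝ) ≤ n := by exact_mod_cast hpos
  have hw : (w : ℝ) ≤ n := by exact_mod_cast h
  have hw0 : (0 : ℝ) ≤ w := Nat.cast_nonneg w
  have hy : (0 : ℝ) < (1 + (n + w)) / (1 + n) := by positivity
  have key := Real.one_sub_inv_le_log_of_pos hy
  rw [Real.log_div (by positivity) (by positivity)] at key
  have e : 1 - ((1 + ((n : ℝ) + w)) / (1 + n))⁻¹ = w / (1 + (n + w)) := by
    field_simp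
    ring
  rw [e] at key
  have h3 : (w : ℝ) / n ≤ 3 * (w / (1 + (n + w))) := by
    rw [← mul_div_assoc, div_le_div_iff₀ (by positivity) (by positivity)]
    nlinarith
  push_cast
  linarith

/-! ### The recursion for the gap between the two value estimates -/

/-- The analytic core of the bound for a single episode.  Here `y t` stands for `1 / √n_t`, `d t` for
the gap between the upper and the lower estimate, and `e t` for the excess of the upper estimate
over the remaining return. -/
theorem excess_le_of_gap_recursion {H : ℕ} {β B : ℝ} {y d e : ℕ → ℝ} (hβ : 0 ≤ β) (hB : 0 ≤ B)
    (hy0 : ∀ t < H, 0 ≤ y t) (hy1 : ∀ t < H, y t ≤ 1)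
    (hdH : ∀ t ≤ H, d t ≤ H) (hd : d H = 0) (he : e H = 0)
    (hdrec : ∀ t < H, d t ≤ 2 * (β * y t ^ 2 + B * y t * d (t + 1)) + d (t + 1))
    (herec : ∀ t < H, e t ≤ β * y t ^ 2 + B * y t * d (t + 1) + e (t + 1)) :
    e 0 ≤ (β + 2 * B * (β + B * H) * H) * ∑ t ∈ range H, y t ^ 2 := by
  set Y := ∑ t ∈ range H, y t with hY
  have hY0 : 0 ≤ Y := sum_nonneg fun t ht => hy0 t (mem_range.1 ht)
  have hH0 : (0 : ℝ) ≤ H := Nat.cast_nonneg H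
  have hD : 0 ≤ β + B * H := by positivity
  -- Bounding one factor of `1 / n` by `1 / √n` and `d (t + 1)` by `H` makes the recursion additive.
  have step : ∀ t < H, d t ≤ 2 * (β + B * H) * y t + d (t + 1) := by
    intro t ht
    have h1 : β * y t ^ 2 ≤ β * y t :=
      mul_le_mul_of_nonneg_left (by nlinarith [hy0 t ht, hy1 t ht]) hβ
    have h2 : B * y t * d (t + 1) ≤ B * y t * H :=
      mul_le_mul_of_nonneg_left (hdH _ ht) (mul_nonneg hB (hy0 t ht))
    linarith [hdrec t ht]
  have hdsum : ∀ t ≤ H, d t ≤ 2 * (β + B * H) * ∑ τ ∈ Ico t H, y τ := by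
    intro t ht
    induction ht using Nat.decreasingInduction with
    | self => simp [hd]
    | of_succ t ht ih =>
      rw [Finset.sum_eq_sum_Ico_succ_bot ht, mul_add]
      linarith [step t ht]
  have hdY : ∀ t ≤ H, d t ≤ 2 * (β + B * H) * Y := by
    intro t ht
    refine (hdsum t ht).trans (mul_le_mul_of_nonneg_left ?_ (by positivity))
    rw [hY, ← Nat.Ico_zero_eq_range]
    exact sum_le_sum_of_subset_of_nonneg (Ico_subset_Ico_left (Nat.zero_le t))
      fun τ hτ _ => hy0 τ (mem_Ico.1 hτ).2
  have htel : e 0 = ∑ t ∈ range H, (e t - e (t + 1)) := by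
    rw [sum_range_sub', he, sub_zero]
  have hsq : Y ^ 2 ≤ H * ∑ t ∈ range H, y t ^ 2 := by
    simpa using sq_sum_le_card_mul_sum_sq (s := range H) (f := y)
  calc e 0 = ∑ t ∈ range H, (e t - e (t + 1)) := htel
    _ ≤ ∑ t ∈ range H, (β * y t ^ 2 + B * y t * (2 * (β + B * H) * Y)) := by
        refine sum_le_sum fun t ht => ?_
        have ht := mem_range.1 ht
        have := mul_le_mul_of_nonneg_left (hdY (t + 1) ht) (mul_nonneg hB (hy0 t ht))
        linarith [herec t ht]
    _ = β * ∑ t ∈ range H, y t ^ 2 + 2 * B * (β + B * H) * Y ^ 2 := by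
        rw [sum_add_distrib, ← mul_sum, ← sum_mul, ← mul_sum, ← hY]
        ring
    _ ≤ β * ∑ t ∈ range H, y t ^ 2
          + 2 * B * (β + B * H) * (H * ∑ t ∈ range H, y t ^ 2) := by
        have := mul_le_mul_of_nonneg_left hsq (show 0 ≤ 2 * B * (β + B * H) by positivity)
        linarith
    _ = _ := by ring

/-! ### Returns of a deterministic MDP -/

namespace DetMDP

variable {S A : Type*}

/-- The data `D` could have been observed in `M`: every recorded reward and successor is the one
that `M` prescribes. -/
def Generates (M : DetMDP S A) (D : List (Obs S A)) : Prop :=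
  ∀ o ∈ D, o.reward = M.reward o.state o.action ∧ o.nextState = M.next o.state o.action

theorem generates_episode (M : DetMDP S A) (H : ℕ) (π : ℕ → S → A) (s : S) :
    M.Generates (M.episode H π s) := by
  intro o ho
  obtain ⟨t, -, rfl⟩ := List.mem_map.1 ho
  exact ⟨rfl, rfl⟩

theorem value_nonneg (M : DetMDP S A) (H : ℕ) (π : ℕ → S → A) (s : S) : 0 ≤ M.value H π s :=
  sum_nonneg fun _ _ => (M.reward_mem _ _).1

theorem value_le (M : DetMDP S A) (H : ℕ) (π : ℕ → S → A) (s : S) : M.value H π s ≤ H := by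
  have := sum_le_card_nsmul (range H)
    (fun t => M.reward (M.stateAt π s t) (π t (M.stateAt π s t))) 1 fun _ _ => (M.reward_mem _ _).2
  simpa [value] using this

theorem stateAt_succ' (M : DetMDP S A) (π : ℕ → S → A) (s : S) (t : ℕ) :
    M.stateAt π s (t + 1) = M.stateAt (fun i => π (i + 1)) (M.next s (π 0 s)) t := by
  induction t with
  | zero => rfl
  | succ t ih =>
    rw [stateAt, ih]
    rfl

theorem value_succ (M : DetMDP S A) (h : ℕ) (π : ℕ → S → A) (s : S) :
    M.value (h + 1) π s
      = M.reward s (π 0 s) + M.value h (fun i => π (i + 1)) (M.next s (π 0 s)) := by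
  rw [value, sum_range_succ', add_comm]
  simp only [stateAt_succ']
  rfl

end DetMDP

namespace Euler

/-! ### Empirical quantities of deterministic data -/

section Empirical

variable {S A : Type*} [DecidableEq S] [DecidableEq A]

theorem mem_samples {D : List (Obs S A)} {s : S} {a : A} {o : Obs S A} :
    o ∈ samples D s a ↔ o ∈ D ∧ o.state = s ∧ o.action = a := by
  simp [samples]

theorem visits_le_length (D : List (Obs S A)) (s : S) (a : A) : visits D s a ≤ D.length :=
  List.length_filter_le _ _

theorem visits_append (D D' : List (Obs S A)) (s : S) (a : A) :
    visits (D ++ D') s a = visits D s a + visits D' s a := by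
  simp [visits, samples]

theorem visits_episode (M : DetMDP S A) (H : ℕ) (π : ℕ → S → A) (s₀ s : S) (a : A) :
    visits (M.episode H π s₀) s a =
      #{t ∈ range H | (M.stateAt π s₀ t, π t (M.stateAt π s₀ t)) = (s, a)} := by
  simp only [Prod.mk.injEq]
  rw [visits, samples, DetMDP.episode, List.filter_map, List.length_map]
  rfl

variable {M : DetMDP S A} {D : List (Obs S A)} {s : S} {a : A}

theorem pHat_eq [Fintype S] (hD : M.Generates D) (hv : visits D s a ≠ 0) :
    pHat D s a = fun s' => if s' = M.next s a then 1 else 0 := by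
  have hnext : ∀ o ∈ samples D s a, o.nextState = M.next s a := by
    intro o ho
    obtain ⟨hoD, rfl, rfl⟩ := mem_samples.1 ho
    exact (hD o hoD).2
  funext s'
  unfold pHat
  split_ifs with h
  · rw [List.filter_eq_self.2 fun o ho => by simp [hnext o ho, h]]
    exact div_self (Nat.cast_ne_zero.2 hv)
  · rw [List.filter_eq_nil_iff.2 fun o ho => by simp [hnext o ho, Ne.symm h]]
    simp

theorem reward_of_mem_samples (hD : M.Generates D) :
    ∀ o ∈ samples D s a, o.reward = M.reward s a := by
  intro o ho
  obtain ⟨hoD, rfl, rfl⟩ := mem_samples.1 ho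
  exact (hD o hoD).1

theorem rHat_eq (hD : M.Generates D) (hv : visits D s a ≠ 0) : rHat D s a = M.reward s a := by
  have hv' : (visits D s a : ℝ) ≠ 0 := Nat.cast_ne_zero.2 hv
  rw [rHat, List.map_congr_left (reward_of_mem_samples hD), List.map_const', List.sum_replicate,
    nsmul_eq_mul]
  exact mul_div_cancel_left₀ _ hv'

theorem rVar_eq (hD : M.Generates D) (hv : visits D s a ≠ 0) : rVar D s a = 0 := by
  rw [rVar, List.map_congr_left (g := fun _ => (0 : ℝ))]
  · simp
  · intro o ho
    rw [reward_of_mem_samples hD o ho, rHat_eq hD hv]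
    simp

variable [Fintype S]

theorem mean_pHat (hD : M.Generates D) (hv : visits D s a ≠ 0) (V : S → ℝ) :
    mean (pHat D s a) V = V (M.next s a) := by
  simp [mean, pHat_eq hD hv]

theorem variance_pHat (hD : M.Generates D) (hv : visits D s a ≠ 0) (V : S → ℝ) :
    variance (pHat D s a) V = 0 := by
  rw [variance, mean_pHat hD hv]
  simp [pHat_eq hD hv]

theorem norm2_pHat (hD : M.Generates D) (hv : visits D s a ≠ 0) (X : S → ℝ) :
    norm2 (pHat D s a) X = |X (M.next s a)| := by
  simp [norm2, pHat_eq hD hv, Real.sqrt_sq_eq_abs]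

/-- The coefficient of `1 / n` in the total bonus of a visited pair with deterministic data. -/
noncomputable def bonusCoeff (L : ℝ) (H : ℕ) : ℝ := 7 * L / 3 + 5 * constJ L H + constBp L H

/-- The total bonus of a visited pair with deterministic data, where `x` is the gap between the two
estimates at the successor. -/
noncomputable def detBonus (L : ℝ) (H n : ℕ) (x : ℝ) : ℝ :=
  bonusCoeff L H * (1 / √n) ^ 2 + constBv L * (1 / √n) * |x|

theorem rewardBonus_add_transBonus (hD : M.Generates D) (hv : visits D s a ≠ 0) (L : ℝ) (H : ℕ)
    (Vup Vlo V : S → ℝ) :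
    rewardBonus L D s a + transBonus L H D Vup Vlo s a V
      = detBonus L H (visits D s a) (Vup (M.next s a) - Vlo (M.next s a)) := by
  rw [rewardBonus, transBonus, phi, rVar_eq hD hv, variance_pHat hD hv, norm2_pHat hD hv, detBonus,
    bonusCoeff]
  have hn : (0 : ℝ) < visits D s a := by exact_mod_cast Nat.pos_of_ne_zero hv
  have h0 : √(visits D s a : ℝ) ≠ 0 := (Real.sqrt_pos.2 hn).ne'
  obtain ⟨q, hq, hqn⟩ : ∃ q : ℝ, q ≠ 0 ∧ (visits D s a : ℝ) = q ^ 2 ∧ √(visits D s a : ℝ) = q :=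
    ⟨_, h0, (Real.sq_sqrt hn.le).symm, rfl⟩
  rw [hqn.2, hqn.1]
  simp only [mul_zero, zero_mul, zero_div, Real.sqrt_zero]
  field_simp
  ring

theorem qUp_eq (hD : M.Generates D) (hv : visits D s a ≠ 0) (L : ℝ) (H h : ℕ) (Vup Vlo : S → ℝ) :
    qUp L H D h Vup Vlo s a = min (h : ℝ) (M.reward s a + Vup (M.next s a)
      + detBonus L H (visits D s a) (Vup (M.next s a) - Vlo (M.next s a))) := by
  rw [qUp, if_neg hv, ← rewardBonus_add_transBonus hD hv L H Vup Vlo Vup, rHat_eq hD hv,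
    mean_pHat hD hv]
  congr 1
  ring

theorem qLo_eq (hD : M.Generates D) (hv : visits D s a ≠ 0) (L : ℝ) (H : ℕ) (Vup Vlo : S → ℝ) :
    qLo L H D Vup Vlo s a = max 0 (M.reward s a + Vlo (M.next s a)
      - detBonus L H (visits D s a) (Vup (M.next s a) - Vlo (M.next s a))) := by
  rw [qLo, if_neg hv, ← rewardBonus_add_transBonus hD hv L H Vup Vlo Vlo, rHat_eq hD hv,
    mean_pHat hD hv]
  congr 1
  ring

end Empirical

/-! ### Optimism and ordering of the value estimates -/

theorem bonusCoeff_nonneg {L : ℝ} (hL : 0 ≤ L) (H : ℕ) : 0 ≤ bonusCoeff L H := by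
  unfold bonusCoeff constJ constBp
  positivity

theorem detBonus_nonneg {L : ℝ} (hL : 0 ≤ L) (H n : ℕ) (x : ℝ) : 0 ≤ detBonus L H n x := by
  have := bonusCoeff_nonneg hL H
  unfold detBonus constBv
  positivity

theorem sqrt_two_mul_le {L : ℝ} (hL : 1 ≤ L) : √(2 * L) ≤ 2 * L := by
  rw [Real.sqrt_le_left (by linarith)]
  nlinarith

theorem bonusCoeff_le {L : ℝ} {H : ℕ} (hL : 1 ≤ L) (hH : 1 ≤ H) : bonusCoeff L H ≤ 6 * (H * L) := by
  have hH' : (1 : ℝ) ≤ H := by exact_mod_cast hH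
  have h1 := mul_le_mul_of_nonneg_left (sqrt_two_mul_le hL) (show (0 : ℝ) ≤ H by positivity)
  have h2 : L ≤ H * L := le_mul_of_one_le_left (by linarith) hH'
  unfold bonusCoeff constJ constBp
  linarith

section Planning

variable {S A : Type*} [Fintype S] [DecidableEq S] [DecidableEq A]
variable {M : DetMDP S A} {D : List (Obs S A)} {L : ℝ} {sel : ℕ → S → (A → ℝ) → A}

theorem bounds_fst_le (H h : ℕ) (s : S) : (bounds sel L H D h).1 s ≤ h := by
  cases h with
  | zero => simp [bounds]
  | succ h =>
    simp only [bounds, qUp]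
    split_ifs
    · exact le_rfl
    · exact min_le_left _ _

theorem bounds_snd_nonneg (H h : ℕ) (s : S) : 0 ≤ (bounds sel L H D h).2 s := by
  cases h with
  | zero => simp [bounds]
  | succ h =>
    simp only [bounds, qLo]
    split_ifs
    · exact le_rfl
    · exact le_max_left _ _

theorem bounds_snd_le_fst (hD : M.Generates D) (hL : 0 ≤ L) (H h : ℕ) (s : S) :
    (bounds sel L H D h).2 s ≤ (bounds sel L H D h).1 s := by
  induction h generalizing s with
  | zero => simp [bounds]
  | succ h ih =>
    simp only [bounds]
    set V := bounds sel L H D h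
    set a := sel h s (qUp L H D (h + 1) V.1 V.2 s)
    by_cases hv : visits D s a = 0
    · simp only [qLo, qUp, if_pos hv]
      positivity
    rw [qUp_eq hD hv, qLo_eq hD hv]
    have hb := detBonus_nonneg hL H (visits D s a) (V.1 (M.next s a) - V.2 (M.next s a))
    have hr := M.reward_mem s a
    have h1 := ih (M.next s a)
    have h2 : 0 ≤ V.2 (M.next s a) := bounds_snd_nonneg H h _
    have h3 : V.1 (M.next s a) ≤ h := bounds_fst_le H h _
    refine max_le (le_min (by positivity) (by linarith [hr.1])) (le_min ?_ (by linarith))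
    push_cast
    linarith [hr.2]

/-- Optimism: the upper estimate dominates the return of every policy.  The argument is exact, since
the empirical model never errs on visited pairs. -/
theorem value_le_bounds_fst (hD : M.Generates D) (hL : 0 ≤ L)
    (hsel : ∀ h s (q : A → ℝ) a, q a ≤ q (sel h s q))
    (H h : ℕ) (π : ℕ → S → A) (s : S) : M.value h π s ≤ (bounds sel L H D h).1 s := by
  induction h generalizing π s with
  | zero => simp [bounds, DetMDP.value]
  | succ h ih =>
    have hcap := M.value_le (h + 1) π s
    rw [DetMDP.value_succ] at hcap ⊢
    set a := π 0 s
    refine le_trans ?_ (hsel h s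
      (qUp L H D (h + 1) (bounds sel L H D h).1 (bounds sel L H D h).2 s) a)
    by_cases hv : visits D s a = 0
    · rwa [qUp, if_pos hv]
    rw [qUp_eq hD hv]
    refine le_min hcap ?_
    have := detBonus_nonneg hL H (visits D s a)
      ((bounds sel L H D h).1 (M.next s a) - (bounds sel L H D h).2 (M.next s a))
    linarith [ih (fun i => π (i + 1)) (M.next s a)]

/-! ### The regret of one episode -/

/-- If every pair on the trajectory of the planned policy has been visited before, the regret of the
episode is of order `H² L² ∑ 1 / n`. -/
theorem bounds_fst_sub_value_le (hD : M.Generates D) (hL : 1 ≤ L) {H : ℕ} (hH : 1 ≤ H) (s : S)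
    (hv : ∀ t < H, visits D (M.stateAt (policy sel L H D) s t)
      (policy sel L H D t (M.stateAt (policy sel L H D) s t)) ≠ 0) :
    (bounds sel L H D H).1 s - M.value H (policy sel L H D) s ≤
      38 * (H ^ 2 * L ^ 2) * ∑ t ∈ range H, (1 : ℝ) /
        visits D (M.stateAt (policy sel L H D) s t)
          (policy sel L H D t (M.stateAt (policy sel L H D) s t)) := by
  have hL0 : 0 ≤ L := by linarith
  set π := policy sel L H D with hπ
  set x := M.stateAt π s with hx
  set n : ℕ → ℕ := fun t => visits D (x t) (π t (x t)) with hn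
  let U : ℕ → ℝ := fun t => (bounds sel L H D (H - t)).1 (x t)
  let W : ℕ → ℝ := fun t => (bounds sel L H D (H - t)).2 (x t)
  have hWU : ∀ t, W t ≤ U t := fun t => bounds_snd_le_fst hD hL0 _ _ _
  have hU : ∀ t < H, U t ≤ M.reward (x t) (π t (x t)) + U (t + 1)
      + detBonus L H (n t) (U (t + 1) - W (t + 1)) := by
    intro t ht
    have e1 : H - t = H - 1 - t + 1 := by omega
    have e2 : H - (t + 1) = H - 1 - t := by omega
    simp only [U, W, e1, e2]
    exact (qUp_eq hD (hv t ht) L H _ _ _).trans_le (min_le_right _ _)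
  have hW : ∀ t < H, M.reward (x t) (π t (x t)) + W (t + 1)
      - detBonus L H (n t) (U (t + 1) - W (t + 1)) ≤ W t := by
    intro t ht
    have e1 : H - t = H - 1 - t + 1 := by omega
    have e2 : H - (t + 1) = H - 1 - t := by omega
    simp only [U, W, e1, e2]
    exact (le_max_right _ _).trans_eq (qLo_eq hD (hv t ht) L H _ _).symm
  have hbonus : ∀ t, detBonus L H (n t) (U (t + 1) - W (t + 1)) =
      bonusCoeff L H * (1 / √(n t)) ^ 2 + constBv L * (1 / √(n t)) * (U (t + 1) - W (t + 1)) := by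
    intro t
    rw [detBonus, abs_of_nonneg (sub_nonneg.2 (hWU _))]
  have hβ := bonusCoeff_nonneg hL0 H
  have hB : 0 ≤ constBv L := Real.sqrt_nonneg _
  have key := excess_le_of_gap_recursion (H := H) (y := fun t => 1 / √(n t))
    (d := fun t => U t - W t)
    (e := fun t => U t - ∑ i ∈ Ico t H, M.reward (x i) (π i (x i))) hβ hB
    (fun t _ => by positivity)
    (fun t ht => by
      have : (1 : ℝ) ≤ n t := by exact_mod_cast Nat.one_le_iff_ne_zero.2 (hv t ht)
      exact div_le_one_of_le₀ (Real.one_le_sqrt.2 this) (Real.sqrt_nonneg _))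
    (fun t _ => by
      have h1 : U t ≤ ((H - t : ℕ) : ℝ) := bounds_fst_le H _ _
      have h2 : ((H - t : ℕ) : ℝ) ≤ H := by exact_mod_cast Nat.sub_le H t
      have h3 : 0 ≤ W t := bounds_snd_nonneg H _ _
      linarith)
    (by simp [U, W, bounds]) (by simp [U, bounds])
    (fun t ht => by
      have h1 := hU t ht
      have h2 := hW t ht
      rw [hbonus] at h1 h2
      linarith)
    (fun t ht => by
      have h1 := hU t ht
      rw [hbonus] at h1
      rw [Finset.sum_eq_sum_Ico_succ_bot ht]
      linarith)
  have hsq : ∀ t, (1 / √(n t : ℝ)) ^ 2 = 1 / (n t : ℝ) := by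
    intro t
    rw [div_pow, one_pow, Real.sq_sqrt (Nat.cast_nonneg _)]
  simp only [hsq, Nat.Ico_zero_eq_range] at key
  refine le_trans key (mul_le_mul_of_nonneg_right ?_ (sum_nonneg fun t _ => by positivity))
  have hc := bonusCoeff_le hL hH
  have hBv : constBv L ≤ 2 * L := sqrt_two_mul_le hL
  have hH' : (1 : ℝ) ≤ H := by exact_mod_cast hH
  have hHL : (1 : ℝ) ≤ H * L := one_le_mul_of_one_le_of_one_le hH' hL
  have h8 : bonusCoeff L H + constBv L * H ≤ 8 * (H * L) := by
    linarith [mul_le_mul_of_nonneg_right hBv (show (0 : ℝ) ≤ H by positivity)]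
  have h32 : 2 * constBv L * (bonusCoeff L H + constBv L * H) * H
      ≤ 2 * (2 * L) * (8 * (H * L)) * H := by
    gcongr
  have h6 : (H : ℝ) * L ≤ (H * L) ^ 2 := by nlinarith
  linarith

/-- The potential whose increase pays for the regret of an episode. -/
noncomputable def potential [Fintype A] (D : List (Obs S A)) : ℝ :=
  ∑ z : S × A, Real.log (1 + (visits D z.1 z.2 : ℝ))

theorem episode_regret_le [Fintype A] (hD : M.Generates D) (hL : 1 ≤ L)
    (hsel : ∀ h s (q : A → ℝ) a, q a ≤ q (sel h s q)) {H : ℕ} (hH : 1 ≤ H) (s : S) :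
    M.optValue H s - M.value H (policy sel L H D) s ≤
      114 * (H ^ 2 * L ^ 2) *
        (potential (D ++ M.episode H (policy sel L H D) s) - potential D) := by
  set π := policy sel L H D with hπ
  have hH' : (1 : ℝ) ≤ H := by exact_mod_cast hH
  have : Nonempty (ℕ → S → A) := ⟨π⟩
  have hopt : M.optValue H s ≤ (bounds sel L H D H).1 s :=
    ciSup_le fun π' => value_le_bounds_fst hD (by linarith) hsel H H π' s
  set w : S × A → ℕ := fun z => visits (M.episode H π s) z.1 z.2 with hw
  have hinc : potential (D ++ M.episode H π s) - potential D = ∑ z : S × A,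
      (Real.log (1 + ((visits D z.1 z.2 + w z : ℕ) : ℝ))
        - Real.log (1 + (visits D z.1 z.2 : ℝ))) := by
    rw [potential, potential, ← sum_sub_distrib]
    simp only [visits_append, hw]
  rw [hinc]
  by_cases hbad : ∃ z : S × A, visits D z.1 z.2 < w z
  · -- The count of `z` at least doubles, so the trivial bound `H` is affordable.
    obtain ⟨z, hz⟩ := hbad
    have h1 := (log_two_le_log_sub_log hz).trans (single_le_sum
      (f := fun z : S × A => Real.log (1 + ((visits D z.1 z.2 + w z : ℕ) : ℝ))
        - Real.log (1 + (visits D z.1 z.2 : ℝ))) (fun _ _ => log_one_add_sub_nonneg) (mem_univ z))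
    have h2 : M.optValue H s - M.value H π s ≤ H := by
      linarith [bounds_fst_le (sel := sel) (L := L) (D := D) H H s, M.value_nonneg H π s]
    have hlog := Real.log_two_gt_d9
    have h3 : (H : ℝ) ≤ H ^ 2 * L ^ 2 := by nlinarith [one_le_pow₀ hL (n := 2)]
    refine h2.trans (h3.trans ?_)
    have : (0 : ℝ) ≤ H ^ 2 * L ^ 2 := by positivity
    nlinarith
  · push Not at hbad
    have hcount : ∀ z, w z = #{t ∈ range H | (M.stateAt π s t, π t (M.stateAt π s t)) = z} :=
      fun z => visits_episode M H π s z.1 z.2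
    have hvis : ∀ t < H, visits D (M.stateAt π s t) (π t (M.stateAt π s t)) ≠ 0 := by
      intro t ht h0
      have h1 := hbad (M.stateAt π s t, π t (M.stateAt π s t))
      have h2 : 0 < w (M.stateAt π s t, π t (M.stateAt π s t)) := by
        rw [hcount, card_pos]
        exact ⟨t, by simp [ht]⟩
      dsimp only at h1
      omega
    have hsum : ∑ t ∈ range H, (1 : ℝ) / visits D (M.stateAt π s t) (π t (M.stateAt π s t))
        = ∑ z : S × A, (w z : ℝ) / visits D z.1 z.2 := by
      rw [← sum_fiberwise (range H) (fun t => (M.stateAt π s t, π t (M.stateAt π s t)))]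
      refine sum_congr rfl fun z _ => ?_
      rw [sum_congr rfl (g := fun _ => (1 : ℝ) / visits D z.1 z.2), sum_const, hcount, nsmul_eq_mul,
        mul_one_div]
      intro t ht
      rw [← (mem_filter.1 ht).2]
    have h1 := bounds_fst_sub_value_le hD hL hH s hvis
    rw [hsum] at h1
    have h2 : ∑ z : S × A, (w z : ℝ) / visits D z.1 z.2 ≤ 3 * ∑ z : S × A,
        (Real.log (1 + ((visits D z.1 z.2 + w z : ℕ) : ℝ))
          - Real.log (1 + (visits D z.1 z.2 : ℝ))) := by
      rw [mul_sum]
      exact sum_le_sum fun z _ => div_le_three_mul_log_sub_log (hbad z)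
    have h3 := mul_le_mul_of_nonneg_left h2 (show (0 : ℝ) ≤ 38 * (H ^ 2 * L ^ 2) by positivity)
    linarith

end Planning

/-! ### Summation over the episodes -/

section History

variable {S A : Type*} [Fintype S] [DecidableEq S] [DecidableEq A]

theorem generates_history (M : DetMDP S A) (sel : ℕ → ℕ → S → (A → ℝ) → A) (L : ℝ) (H : ℕ)
    (s₁ : ℕ → S) (k : ℕ) : M.Generates (history M sel L H s₁ k) := by
  induction k with
  | zero => simp [history, DetMDP.Generates]
  | succ k ih =>
    intro o ho
    rcases List.mem_append.1 ho with ho | ho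
    · exact ih o ho
    · exact M.generates_episode _ _ _ o ho

theorem length_history (M : DetMDP S A) (sel : ℕ → ℕ → S → (A → ℝ) → A) (L : ℝ) (H : ℕ)
    (s₁ : ℕ → S) (k : ℕ) : (history M sel L H s₁ k).length = k * H := by
  induction k with
  | zero => simp [history]
  | succ k ih => simp [history, ih, DetMDP.episode, Nat.succ_mul]

theorem potential_le [Fintype A] (D : List (Obs S A)) :
    potential D ≤ Fintype.card S * Fintype.card A * Real.log (1 + (D.length : ℝ)) := by
  have := sum_le_card_nsmul (univ : Finset (S × A))
    (fun z => Real.log (1 + (visits D z.1 z.2 : ℝ))) (Real.log (1 + (D.length : ℝ))) fun z _ => by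
      apply Real.log_le_log (by positivity)
      have : (visits D z.1 z.2 : ℝ) ≤ D.length := by exact_mod_cast visits_le_length D z.1 z.2
      linarith
  simpa [potential] using this

theorem regret_le_potential [Fintype A] (M : DetMDP S A) (sel : ℕ → ℕ → S → (A → ℝ) → A)
    (hsel : ∀ k h s (q : A → ℝ) a, q a ≤ q (sel k h s q)) {H : ℕ} (hH : 1 ≤ H) (K : ℕ) {δ : ℝ}
    (hL : 1 ≤ logTerm S A H K δ) (s₁ : ℕ → S) :
    regret M sel H K δ s₁ ≤ 114 * (H ^ 2 * logTerm S A H K δ ^ 2) *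
      potential (history M sel (logTerm S A H K δ) H s₁ K) := by
  set L := logTerm S A H K δ
  have hsum := sum_range_sub (fun k => potential (history M sel L H s₁ k)) K
  have h0 : potential (history M sel L H s₁ 0) = 0 := by simp [potential, history, visits, samples]
  rw [h0, sub_zero] at hsum
  rw [← hsum, mul_sum]
  exact sum_le_sum fun k _ =>
    episode_regret_le (generates_history M sel L H s₁ k) hL (hsel k) hH (s₁ k)

end History

end Euler

theorem mainTheorem5 :
    ∃ C : ℝ, 0 < C ∧ ∃ m : ℕ,
      ∀ (S A : Type*) [Fintype S] [DecidableEq S] [Fintype A] [DecidableEq A]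
        (M : DetMDP S A) (H K : ℕ) (δ : ℝ), 0 < δ → δ < 1 →
      ∀ sel : ℕ → ℕ → S → (A → ℝ) → A,
        (∀ k h s (q : A → ℝ) a, q a ≤ q (sel k h s q)) →
      ∀ s₁ : ℕ → S,
        Euler.regret M sel H K δ s₁ ≤
          C * (Fintype.card S * Fintype.card A * (H : ℝ) ^ 2) *
            Real.log (28 * Fintype.card S * Fintype.card A * ((K : ℝ) * H) / δ) ^ m := by
  refine ⟨114, by norm_num, 3, ?_⟩
  intro S A _ _ _ _ M H K δ hδ hδ1 sel hsel s₁
  rcases Nat.eq_zero_or_pos K with rfl | hK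
  · simp [Euler.regret]
  rcases Nat.eq_zero_or_pos H with rfl | hH
  · simp [Euler.regret, DetMDP.optValue, DetMDP.value]
  have : Nonempty S := ⟨s₁ 0⟩
  have : Nonempty A := ⟨sel 0 0 (s₁ 0) fun _ => 0⟩
  have hlog : Euler.logTerm S A H K δ =
      Real.log (28 * Fintype.card S * Fintype.card A * ((K : ℝ) * H) / δ) := by
    rw [Euler.logTerm]
    congr 1
    field_simp
    ring
  rw [← hlog]
  have hT : (1 : ℝ) ≤ (K : ℝ) * H := by exact_mod_cast Nat.mul_pos hK hH
  have hSA : (1 : ℝ) ≤ (Fintype.card S : ℝ) * Fintype.card A := by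
    exact_mod_cast Nat.mul_pos Fintype.card_pos Fintype.card_pos
  have harg : 28 * ((K : ℝ) * H) ≤ 28 * Fintype.card S * Fintype.card A * ((K : ℝ) * H) / δ := by
    rw [le_div_iff₀ hδ]
    calc 28 * ((K : ℝ) * H) * δ ≤ 28 * ((K : ℝ) * H) * 1 := by gcongr
      _ ≤ 28 * ((K : ℝ) * H) * (Fintype.card S * Fintype.card A) := by gcongr
      _ = _ := by ring
  have hL : 1 ≤ Euler.logTerm S A H K δ := by
    rw [hlog, Real.le_log_iff_exp_le (by linarith)]
    linarith [Real.exp_one_lt_d9]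
  have hpot : Euler.potential (Euler.history M sel (Euler.logTerm S A H K δ) H s₁ K) ≤
      Fintype.card S * Fintype.card A * Euler.logTerm S A H K δ := by
    refine (Euler.potential_le _).trans (mul_le_mul_of_nonneg_left ?_ (by positivity))
    rw [Euler.length_history, hlog]
    apply Real.log_le_log (by positivity)
    push_cast
    linarith
  refine (Euler.regret_le_potential M sel hsel hH K hL s₁).trans
    ((mul_le_mul_of_nonneg_left hpot (by positivity)).trans_eq ?_)
  ring
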